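/- A permutation of $[n]$ is regarded as a word $\pi_1\pi_2\cdots\pi_n$; it avoids a pattern $p=p_1\cdots p_k$ if no subsequence of $k$ of its entries is in the same relative order as $p_1\cdots p_k$. Call a permutation start-small if it does not start with its largest entry (the empty permutation is start-small). For $n\ge 0$ let $u_n$ be the number of permutations of $[n]$ that avoid both $1243$ and $2134$, and let $v_n$ be the number of these that are start-small. Let $F(x)=\sum_{n\ge 0}u_n x^n$ and $G(x)=\sum_{n\ge 0}v_n x^n$, and let $C(x)=\sum_{n\ge 0}\frac{1}{n+1}\binom{2n}{n}x^n=\frac{1-\sqrt{1-4x}}{2x}$ be the generating function of the Catalan numbers. Then, as formal power series over $\mathbb{Q}$ (where $\sqrt{1-4x}$ is the square root of $1-4x$ with constant term $1$), $$G(x)=1+\frac{x}{1-x\,C(x)^3}-x,\qquad F(x)=\frac{G(x)}{1-x},$$ and $$F(x)=\frac{3x^2-9x+2+x(1-x)\sqrt{1-4x}}{2(x-1)(x^2+4x-1)}.$$ In particular, Kotesovec's conjectured generating function for the sequence A164651 of the On-Line Encyclopedia of Integer Sequences is correct. -/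

import Mathlib

open PowerSeries

namespace PermPattern

/-- The permutation `π` of `{0, …, n-1}` (standing for a permutation of `[n]`, read as the word
`π 0, π 1, …, π (n-1)`) contains the pattern `p`, given by its one-line word: some `k` entries of
`π`, at increasing positions, are in the same relative order as the letters of `p`. -/
def Contains {n k : ℕ} (π : Equiv.Perm (Fin n)) (p : Fin k → ℕ) : Prop :=
  ∃ f : Fin k → Fin n, StrictMono f ∧ ∀ i j : Fin k, π (f i) < π (f j) ↔ p i < p j

/-- `π` avoids both of the patterns 1243 and 2134. -/
def IsAvoider {n : ℕ} (π : Equiv.Perm (Fin n)) : Prop :=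
  ¬ Contains π ![1, 2, 4, 3] ∧ ¬ Contains π ![2, 1, 3, 4]

/-- `π` is start-small: it does not start with its largest entry. (The empty permutation is
start-small, the permutation of length 1 is not.) -/
def IsStartSmall {n : ℕ} (π : Equiv.Perm (Fin n)) : Prop :=
  ¬ ∃ i : Fin n, (i : ℕ) = 0 ∧ ∀ j : Fin n, π j ≤ π i

/-- The number of `{1243, 2134}`-avoiders of length `n`. -/
noncomputable def numAvoiders (n : ℕ) : ℕ :=
  Nat.card {π : Equiv.Perm (Fin n) // IsAvoider π}

/-- The number of start-small `{1243, 2134}`-avoiders of length `n`. -/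
noncomputable def numStartSmallAvoiders (n : ℕ) : ℕ :=
  Nat.card {π : Equiv.Perm (Fin n) // IsAvoider π ∧ IsStartSmall π}

/-- The generating function `F(x) = ∑_{n ≥ 0} u_n x^n` of `{1243, 2134}`-avoiders. -/
noncomputable def avoiderSeries : ℚ⟦X⟧ :=
  PowerSeries.mk fun n => (numAvoiders n : ℚ)

/-- The generating function `G(x) = ∑_{n ≥ 0} v_n x^n` of start-small `{1243, 2134}`-avoiders. -/
noncomputable def startSmallSeries : ℚ⟦X⟧ :=
  PowerSeries.mk fun n => (numStartSmallAvoiders n : ℚ)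

/-- The generating function `C(x)` of the Catalan numbers, with rational coefficients. -/
noncomputable def catalanGF : ℚ⟦X⟧ :=
  PowerSeries.mk fun n => (catalan n : ℚ)

/-- The power series `√(1 - 4x)`: the binomial series `(1 + x)^(1/2)` with `-4x` put for `x`. -/
noncomputable def sqrtSeries : ℚ⟦X⟧ :=
  PowerSeries.rescale (-4 : ℚ) (PowerSeries.binomialSeries ℚ (1 / 2 : ℚ))

theorem sqrtSeries_sq : sqrtSeries ^ 2 = 1 - 4 * X := by
  have h : PowerSeries.binomialSeries ℚ (1 / 2 : ℚ) ^ 2 = 1 + X := by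
    rw [sq, ← PowerSeries.binomialSeries_add]
    have := PowerSeries.binomialSeries_nat (R := ℚ) (A := ℚ) 1
    norm_num at this ⊢
    exact this
  rw [sqrtSeries, ← map_pow, h, map_add, map_one, PowerSeries.rescale_X]
  have h4 : (C (-4 : ℚ) : ℚ⟦X⟧) = -4 := by
    rw [map_neg, map_ofNat]
  simp only [h4]
  ring

theorem constantCoeff_sqrtSeries : PowerSeries.constantCoeff sqrtSeries = 1 := by
  rw [sqrtSeries, ← PowerSeries.coeff_zero_eq_constantCoeff_apply, PowerSeries.coeff_rescale,
    PowerSeries.binomialSeries_coeff]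
  simp

end PermPattern

namespace PermPattern

/-- The word `w` of length `n` with the letter `n` inserted at position `v`. -/
def insertMax (n : ℕ) (w : ℕ → ℕ) (v i : ℕ) : ℕ :=
  if i < v then w i else if i = v then n else w (i - 1)

/-- The word of length `n` given by `w` avoids `1243` and `2134`. -/
def WordAvoids (n : ℕ) (w : ℕ → ℕ) : Prop :=
  (∀ p q r s, p < q → q < r → r < s → s < n → w p < w q → w q < w s → ¬ w s < w r) ∧
    ∀ p q r s, p < q → q < r → r < s → s < n → w q < w p → w p < w r → ¬ w r < w s

/-- Inserting a new maximum at position `v` of the word `w` creates no forbidden pattern. -/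
def Active (n : ℕ) (w : ℕ → ℕ) (v : ℕ) : Prop :=
  (∀ p q r, p < q → q < r → r < v → w q < w p → ¬ w p < w r) ∧
    ∀ p q r, p < q → q < v → v ≤ r → r < n → w p < w q → ¬ w q < w r

/-- `w` is injective on `{0, …, n-1}`, with values less than `n`. -/
def IsPermWord (n : ℕ) (w : ℕ → ℕ) : Prop :=
  (∀ i < n, w i < n) ∧ ∀ i < n, ∀ j < n, w i = w j → i = j

theorem insertMax_of_lt {n : ℕ} {w : ℕ → ℕ} {v i : ℕ} (h : i < v) :
    insertMax n w v i = w i := by simp [insertMax, h]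

@[simp] theorem insertMax_self {n : ℕ} {w : ℕ → ℕ} {v : ℕ} : insertMax n w v v = n := by
  simp [insertMax]

theorem insertMax_succ_of_le {n : ℕ} {w : ℕ → ℕ} {v i : ℕ} (h : v ≤ i) :
    insertMax n w v (i + 1) = w i := by
  rw [insertMax, if_neg (by omega), if_neg (by omega)]; rfl

/-- The position in `insertMax n w v` of the letter at position `i` of `w`. -/
def shift (v i : ℕ) : ℕ := if i < v then i else i + 1

theorem insertMax_shift (n : ℕ) (w : ℕ → ℕ) (v i : ℕ) : insertMax n w v (shift v i) = w i := by
  unfold shift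
  split_ifs with h
  · exact insertMax_of_lt h
  · exact insertMax_succ_of_le (by omega)

theorem eq_or_eq_shift (v i : ℕ) : i = v ∨ ∃ k, i = shift v k := by
  rcases lt_trichotomy i v with h | h | h
  · exact Or.inr ⟨i, by simp [shift, h]⟩
  · exact Or.inl h
  · exact Or.inr ⟨i - 1, by unfold shift; split_ifs <;> omega⟩

theorem shift_lt_shift {v i k : ℕ} : shift v i < shift v k ↔ i < k := by
  unfold shift; split_ifs <;> omega

theorem shift_lt_self {v i : ℕ} : shift v i < v ↔ i < v := by
  unfold shift; split_ifs <;> omega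

theorem self_lt_shift {v i : ℕ} : v < shift v i ↔ v ≤ i := by
  unfold shift; split_ifs <;> omega

theorem shift_lt_succ {v i n : ℕ} (hv : v ≤ n) : shift v i < n + 1 ↔ i < n := by
  unfold shift; split_ifs <;> omega

/-- A new maximum can only play the 4. So it completes 2134 from a 213 on its left, or 1243 from a
12 on its left and a 3 on its right. -/
theorem wordAvoids_insertMax {n : ℕ} {w : ℕ → ℕ} {v : ℕ} (hw : ∀ i < n, w i < n) (hv : v ≤ n) :
    WordAvoids (n + 1) (insertMax n w v) ↔ WordAvoids n w ∧ Active n w v := by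
  constructor
  · rintro ⟨h1, h2⟩
    refine ⟨⟨fun p q r s a b c d => ?_, fun p q r s a b c d => ?_⟩,
      fun p q r a b c => ?_, fun p q r a b c d => ?_⟩
    · simpa only [insertMax_shift] using h1 (shift v p) (shift v q) (shift v r) (shift v s)
        (shift_lt_shift.2 a) (shift_lt_shift.2 b) (shift_lt_shift.2 c) ((shift_lt_succ hv).2 d)
    · simpa only [insertMax_shift] using h2 (shift v p) (shift v q) (shift v r) (shift v s)
        (shift_lt_shift.2 a) (shift_lt_shift.2 b) (shift_lt_shift.2 c) ((shift_lt_succ hv).2 d)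
    · intro x y
      have := h2 (shift v p) (shift v q) (shift v r) v
        (shift_lt_shift.2 a) (shift_lt_shift.2 b) (shift_lt_self.2 c) (by omega)
      simp only [insertMax_shift, insertMax_self] at this
      exact this x y (hw r (by omega))
    · intro x y
      have := h1 (shift v p) (shift v q) v (shift v r)
        (shift_lt_shift.2 a) (shift_lt_self.2 b) (self_lt_shift.2 c) ((shift_lt_succ hv).2 d)
      simp only [insertMax_shift, insertMax_self] at this
      exact this x y (hw r (by omega))
  · rintro ⟨⟨h1, h2⟩, h3, h4⟩
    constructor
    · intro p q r s a b c d x y z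
      rcases eq_or_eq_shift v p with hp | ⟨p, rfl⟩ <;>
      rcases eq_or_eq_shift v q with hq | ⟨q, rfl⟩ <;>
      rcases eq_or_eq_shift v r with hr | ⟨r, rfl⟩ <;>
      rcases eq_or_eq_shift v s with hs | ⟨s, rfl⟩ <;>
      try subst hp
      all_goals try subst hq
      all_goals try subst hr
      all_goals try subst hs
      all_goals simp only [insertMax_shift, insertMax_self, shift_lt_shift, shift_lt_self,
        self_lt_shift, shift_lt_succ hv, lt_self_iff_false] at *
      all_goals grind
    · intro p q r s a b c d x y z
      rcases eq_or_eq_shift v p with hp | ⟨p, rfl⟩ <;>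
      rcases eq_or_eq_shift v q with hq | ⟨q, rfl⟩ <;>
      rcases eq_or_eq_shift v r with hr | ⟨r, rfl⟩ <;>
      rcases eq_or_eq_shift v s with hs | ⟨s, rfl⟩ <;>
      try subst hp
      all_goals try subst hq
      all_goals try subst hr
      all_goals try subst hs
      all_goals simp only [insertMax_shift, insertMax_self, shift_lt_shift, shift_lt_self,
        self_lt_shift, shift_lt_succ hv, lt_self_iff_false] at *
      all_goals grind

/-! ### Decreasing prefix and late active sites -/

/-- `j` is the length of the longest decreasing prefix of the nonempty word `w` of length `n`. -/
def IsPrefixLength (n : ℕ) (w : ℕ → ℕ) (j : ℕ) : Prop :=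
  1 ≤ j ∧ j ≤ n ∧ (∀ i, i + 1 < j → w (i + 1) < w i) ∧ (j < n → w (j - 1) < w j)

theorem IsPrefixLength.unique {n : ℕ} {w : ℕ → ℕ} {j k : ℕ} (hj : IsPrefixLength n w j)
    (hk : IsPrefixLength n w k) : j = k := by
  obtain ⟨a1, a2, a3, a4⟩ := hj
  obtain ⟨b1, b2, b3, b4⟩ := hk
  rcases lt_trichotomy j k with h | h | h
  · have := a4 (by omega)
    have := b3 (j - 1) (by omega)
    rw [Nat.sub_add_cancel a1] at this
    omega
  · exact h
  · have := b4 (by omega)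
    have := a3 (k - 1) (by omega)
    rw [Nat.sub_add_cancel b1] at this
    omega

theorem exists_isPrefixLength {n : ℕ} {w : ℕ → ℕ} (hw : IsPermWord n w) (hn : 1 ≤ n) :
    ∃ j, IsPrefixLength n w j := by
  classical
  have hex : ∃ j, 1 ≤ j ∧ (n ≤ j ∨ w (j - 1) < w j) := ⟨n, hn, Or.inl le_rfl⟩
  have hle : Nat.find hex ≤ n := Nat.find_min' hex ⟨hn, Or.inl le_rfl⟩
  refine ⟨Nat.find hex, (Nat.find_spec hex).1, hle, fun i hi => ?_, fun h => ?_⟩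
  · have := Nat.find_min hex hi
    simp only [Nat.add_sub_cancel] at this
    have hne : w (i + 1) ≠ w i := fun h => by
      have := hw.2 (i + 1) (by omega) i (by omega) h
      omega
    omega
  · exact (Nat.find_spec hex).2.resolve_left (by omega)

theorem IsPrefixLength.lt_of_lt {n : ℕ} {w : ℕ → ℕ} {j : ℕ} (hj : IsPrefixLength n w j) {p q : ℕ}
    (hpq : p < q) (hq : q < j) : w q < w p := by
  induction q, hpq using Nat.le_induction with
  | base => exact hj.2.2.1 p hq
  | succ q _ ih => exact (hj.2.2.1 q hq).trans (ih (by omega))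

open Classical in
/-- The active sites of `w` beyond position `j`. -/
noncomputable def lateSites (n : ℕ) (w : ℕ → ℕ) (j : ℕ) : Finset ℕ :=
  (Finset.Ioc j n).filter (Active n w)

theorem mem_lateSites {n : ℕ} {w : ℕ → ℕ} {j v : ℕ} :
    v ∈ lateSites n w j ↔ (j < v ∧ v ≤ n) ∧ Active n w v := by
  simp [lateSites]

/-- Either obstruction needs an ascent, in positions or between the outer letters of a 213, left of
`v`; a decreasing prefix has none. -/
theorem IsPrefixLength.active {n : ℕ} {w : ℕ → ℕ} {j : ℕ} (hj : IsPrefixLength n w j) {v : ℕ}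
    (hv : v ≤ j) : Active n w v := by
  constructor
  · intro p q r a b c
    have := hj.lt_of_lt (a.trans b) (c.trans_le hv)
    omega
  · intro p q r a b c d
    have := hj.lt_of_lt a (b.trans_le hv)
    omega

/-- Sites to the right of the inserted maximum. -/
theorem active_insertMax_of_le {n : ℕ} {w : ℕ → ℕ} {v x : ℕ} (hvx : v ≤ x) (hw : ∀ i < n, w i < n)
    (hx : x ≤ n) :
    Active (n + 1) (insertMax n w v) (x + 1) ↔
      Active n w x ∧ ∀ p q, p < q → q < v → ¬ w q < w p := by
  have hv : v ≤ n := hvx.trans hx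
  have e1 : ∀ i, shift v i < x + 1 ↔ i < x := fun i => shift_lt_succ hvx
  have e2 : ∀ i, x + 1 ≤ shift v i ↔ x ≤ i := fun i => by
    rw [← not_lt, e1, not_lt]
  constructor
  · rintro ⟨h1, h2⟩
    refine ⟨⟨fun p q r a b c => ?_, fun p q r a b c d => ?_⟩, fun p q a b c => ?_⟩
    · simpa only [insertMax_shift] using h1 (shift v p) (shift v q) (shift v r)
        (shift_lt_shift.2 a) (shift_lt_shift.2 b) ((e1 r).2 c)
    · simpa only [insertMax_shift] using h2 (shift v p) (shift v q) (shift v r)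
        (shift_lt_shift.2 a) ((e1 q).2 b) ((e2 r).2 c) ((shift_lt_succ hv).2 d)
    · have := h1 (shift v p) (shift v q) v (shift_lt_shift.2 a) (shift_lt_self.2 b) (by omega)
      simp only [insertMax_shift, insertMax_self] at this
      exact this c (hw p (by omega))
  · rintro ⟨⟨h1, h2⟩, h3⟩
    constructor
    · intro p q r a b c y z
      rcases eq_or_eq_shift v p with hp | ⟨p, rfl⟩ <;>
      rcases eq_or_eq_shift v q with hq | ⟨q, rfl⟩ <;>
      rcases eq_or_eq_shift v r with hr | ⟨r, rfl⟩ <;>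
      try subst hp
      all_goals try subst hq
      all_goals try subst hr
      all_goals simp only [insertMax_shift, insertMax_self, shift_lt_shift, shift_lt_self,
        e1, e2, lt_self_iff_false] at *
      all_goals grind
    · intro p q r a b c d y z
      rcases eq_or_eq_shift v p with hp | ⟨p, rfl⟩ <;>
      rcases eq_or_eq_shift v q with hq | ⟨q, rfl⟩ <;>
      rcases eq_or_eq_shift v r with hr | ⟨r, rfl⟩ <;>
      try subst hp
      all_goals try subst hq
      all_goals try subst hr
      all_goals simp only [insertMax_shift, insertMax_self, shift_lt_shift, shift_lt_self,
        self_lt_shift, shift_lt_succ hv, e1, e2, lt_self_iff_false] at *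
      all_goals grind

theorem lateSites_insertMax {n : ℕ} {w : ℕ → ℕ} {v j : ℕ} (hvj : v ≤ j) (hw : ∀ i < n, w i < n)
    (h : ∀ p q, p < q → q < v → ¬ w q < w p) :
    lateSites (n + 1) (insertMax n w v) (j + 1) = (lateSites n w j).map (addRightEmbedding 1) := by
  ext x
  simp only [Finset.mem_map, mem_lateSites, addRightEmbedding_apply]
  constructor
  · rintro ⟨⟨h1, h2⟩, h3⟩
    obtain ⟨x, rfl⟩ : ∃ y, x = y + 1 := ⟨x - 1, by omega⟩
    exact ⟨x, ⟨⟨by omega, by omega⟩,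
      ((active_insertMax_of_le (by omega) hw (by omega)).1 h3).1⟩, rfl⟩
  · rintro ⟨x, ⟨⟨h1, h2⟩, h3⟩, rfl⟩
    exact ⟨⟨by omega, by omega⟩, (active_insertMax_of_le (by omega) hw (by omega)).2 ⟨h3, h⟩⟩

/-- A descent followed by the new maximum is a 213, which blocks every site further right. -/
theorem not_active_insertMax {n : ℕ} {w : ℕ → ℕ} {v x p q : ℕ} (hvx : v < x)
    (hw : ∀ i < n, w i < n) (hx : x ≤ n + 1) (hpq : p < q) (hq : q < v) (h : w q < w p) :
    ¬ Active (n + 1) (insertMax n w v) x := by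
  obtain ⟨x, rfl⟩ : ∃ y, x = y + 1 := ⟨x - 1, by omega⟩
  rw [active_insertMax_of_le (by omega) hw (by omega)]
  exact fun h' => h'.2 p q hpq hq h

/-- Sites between an ascent and the maximum inserted to its right. -/
theorem not_active_insertMax_of_le {n : ℕ} {w : ℕ → ℕ} {v x p q : ℕ} (hw : ∀ i < n, w i < n)
    (hv : v ≤ n) (hpq : p < q) (hq : q < x) (hx : x ≤ v) (h : w p < w q) :
    ¬ Active (n + 1) (insertMax n w v) x := by
  intro h'
  have := h'.2 p q v hpq hq hx (by omega)
  rw [insertMax_of_lt (by omega), insertMax_of_lt (by omega), insertMax_self] at this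
  exact this h (hw q (by omega))

/-! ### Labels of the children -/

section Children

variable {n : ℕ} {w : ℕ → ℕ} {j : ℕ}

theorem IsPrefixLength.insertMax_zero (hj : IsPrefixLength n w j) (hw : ∀ i < n, w i < n) :
    IsPrefixLength (n + 1) (insertMax n w 0) (j + 1) := by
  obtain ⟨h1, h2, h3, h4⟩ := hj
  refine ⟨by omega, by omega, fun i hi => ?_, fun h => ?_⟩
  · rw [insertMax_succ_of_le (by omega)]
    rcases i with _ | i
    · rw [insertMax_self]; exact hw 0 (by omega)
    · rw [insertMax_succ_of_le (by omega)]; exact h3 i (by omega)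
  · have := h4 (by omega)
    obtain ⟨j, rfl⟩ : ∃ y, j = y + 1 := ⟨j - 1, by omega⟩
    rw [insertMax_succ_of_le (by omega), Nat.add_sub_cancel, insertMax_succ_of_le (by omega)]
    exact this

theorem IsPrefixLength.insertMax_of_le (hj : IsPrefixLength n w j) (hw : ∀ i < n, w i < n) {v : ℕ}
    (hv : 1 ≤ v) (hvj : v ≤ j) : IsPrefixLength (n + 1) (insertMax n w v) v := by
  obtain ⟨h1, h2, h3, h4⟩ := hj
  refine ⟨hv, by omega, fun i hi => ?_, fun h => ?_⟩
  · rw [insertMax_of_lt hi, insertMax_of_lt (by omega)]; exact h3 i (by omega)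
  · rw [insertMax_self, insertMax_of_lt (by omega)]; exact hw _ (by omega)

theorem IsPrefixLength.insertMax_of_lt (hj : IsPrefixLength n w j) {v : ℕ}
    (hjv : j < v) (hv : v ≤ n) : IsPrefixLength (n + 1) (insertMax n w v) j := by
  obtain ⟨h1, h2, h3, h4⟩ := hj
  refine ⟨h1, by omega, fun i hi => ?_, fun h => ?_⟩
  · rw [PermPattern.insertMax_of_lt (by omega), PermPattern.insertMax_of_lt (by omega)]
    exact h3 i (by omega)
  · rw [PermPattern.insertMax_of_lt (by omega), PermPattern.insertMax_of_lt (by omega)]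
    exact h4 (by omega)

theorem card_lateSites_insertMax_zero (hw : ∀ i < n, w i < n) :
    (lateSites (n + 1) (insertMax n w 0) (j + 1)).card = (lateSites n w j).card := by
  rw [lateSites_insertMax (by omega) hw (by omega), Finset.card_map]

/-- The prefix shrinks to length 1, so the old sites `1, …, j`, all still active, now count as late.
-/
theorem card_lateSites_insertMax_one (hj : IsPrefixLength n w j) (hw : ∀ i < n, w i < n) :
    (lateSites (n + 1) (insertMax n w 1) 1).card = (lateSites n w j).card + j := by
  have h0 : lateSites (n + 1) (insertMax n w 1) 1
      = (Finset.Icc 1 j ∪ lateSites n w j).map (addRightEmbedding 1) := by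
    ext x
    simp only [Finset.mem_map, Finset.mem_union, Finset.mem_Icc, mem_lateSites,
      addRightEmbedding_apply]
    have hjn := hj.2.1
    constructor
    · rintro ⟨⟨h1, h2⟩, h3⟩
      obtain ⟨x, rfl⟩ : ∃ y, x = y + 1 := ⟨x - 1, by omega⟩
      have := ((active_insertMax_of_le (by omega) hw (by omega)).1 h3).1
      refine ⟨x, ?_, rfl⟩
      rcases le_or_gt x j with h | h
      · exact Or.inl ⟨by omega, h⟩
      · exact Or.inr ⟨⟨h, by omega⟩, this⟩
    · rintro ⟨x, h, rfl⟩
      have hx : 1 ≤ x ∧ x ≤ n := by have := hj.1; omega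
      refine ⟨⟨by omega, by omega⟩,
        (active_insertMax_of_le (by omega) hw (by omega)).2 ⟨?_, by omega⟩⟩
      rcases h with h | h
      · exact hj.active h.2
      · exact h.2
  rw [h0, Finset.card_map, Finset.card_union_of_disjoint, Nat.card_Icc]
  · omega
  · rw [Finset.disjoint_left]
    intro x hx hx'
    rw [Finset.mem_Icc] at hx
    rw [mem_lateSites] at hx'
    omega

theorem card_lateSites_insertMax_of_le (hj : IsPrefixLength n w j) (hw : ∀ i < n, w i < n) {v : ℕ}
    (hv : 2 ≤ v) (hvj : v ≤ j) : (lateSites (n + 1) (insertMax n w v) v).card = 0 := by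
  rw [Finset.card_eq_zero, Finset.eq_empty_iff_forall_notMem]
  intro x hx
  rw [mem_lateSites] at hx
  exact not_active_insertMax hx.1.1 hw hx.1.2 zero_lt_one (by omega)
    (hj.lt_of_lt zero_lt_one (by omega)) hx.2

/-- The ascent ending the prefix, with the maximum as 3, blocks the late sites up to `v`; the
descent blocks those beyond. -/
theorem card_lateSites_insertMax_of_descent (hj : IsPrefixLength n w j) (hw : ∀ i < n, w i < n)
    {v p q : ℕ} (hjv : j < v) (hv : v ≤ n) (hpq : p < q) (hq : q < v) (h : w q < w p) :
    (lateSites (n + 1) (insertMax n w v) j).card = 0 := by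
  rw [Finset.card_eq_zero, Finset.eq_empty_iff_forall_notMem]
  intro x hx
  rw [mem_lateSites] at hx
  rcases le_or_gt x v with hxv | hxv
  · have := hj.1
    exact not_active_insertMax_of_le hw hv (by omega) hx.1.1 hxv (hj.2.2.2 (by omega)) hx.2
  · exact not_active_insertMax hxv hw hx.1.2 hpq hq h hx.2

/-- Left of the least late site the word increases: if its first descent were at `l, l + 1`, the
site `l + 1` would already be active. -/
theorem lt_of_forall_not_active (hw : IsPermWord n w) (ha : WordAvoids n w)
    (hj : IsPrefixLength n w 1) {v x : ℕ} (hvx : v ≤ x) (hx : x ≤ n) (hxa : Active n w x)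
    (hmin : ∀ y, 1 < y → y < v → ¬ Active n w y) :
    ∀ l, l < v → ∀ q, q ≤ l → ∀ p, p < q → w p < w q := by
  intro l
  induction l with
  | zero => intro _ q hq p hp; omega
  | succ l ih =>
    intro hl
    have ih := ih (by omega)
    suffices h : w l < w (l + 1) by
      intro q hq p hp
      rcases Nat.le_succ_iff.1 hq with hq | rfl
      · exact ih q hq p hp
      · rcases Nat.lt_succ_iff_lt_or_eq.1 hp with h' | rfl
        · exact (ih l le_rfl p h').trans h
        · exact h
    by_contra hlt
    have hne : w (l + 1) ≠ w l := fun h => by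
      have := hw.2 (l + 1) (by omega) l (by omega) h
      omega
    have hd : w (l + 1) < w l := by omega
    have hl0 : l ≠ 0 := by
      rintro rfl
      have := hj.2.2.2 (by omega)
      simp only [Nat.sub_self, zero_add] at *
      omega
    refine hmin (l + 1) (by omega) hl ⟨fun p q r a b c d => ?_, fun p q r a b c d e f => ?_⟩
    · have := ih q (by omega) p a
      omega
    · rcases le_or_gt x r with h | h
      · exact hxa.2 p q r a (by omega) h d e f
      -- Otherwise `l, l + 1, r` is a 213 left of the active site `x`. With `w r < w l`, the
      -- positions `p, q, l, r` form 1243.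
      · have hrl : w r < w l := by
          rcases Nat.eq_or_lt_of_le c with rfl | h'
          · exact hd
          · have h1 := hxa.1 l (l + 1) r (by omega) h' h hd
            have h2 : w l ≠ w r := fun h => by
              have := hw.2 l (by omega) r (by omega) h
              omega
            omega
        have hql : q ≠ l := by rintro rfl; omega
        exact ha.1 p q l r a (by omega) (by omega) d e f hrl

theorem card_lateSites_insertMax_min (hw : IsPermWord n w) (ha : WordAvoids n w)
    (hj : IsPrefixLength n w 1) {v : ℕ} (hv : v ∈ lateSites n w 1)
    (hmin : ∀ y ∈ lateSites n w 1, v ≤ y) :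
    (lateSites (n + 1) (insertMax n w v) 1).card = (lateSites n w 1).card := by
  have hv' := mem_lateSites.1 hv
  have h0 : lateSites (n + 1) (insertMax n w v) 1
      = (lateSites n w 1).map (addRightEmbedding 1) := by
    ext x
    simp only [Finset.mem_map, addRightEmbedding_apply]
    constructor
    · intro hx
      rw [mem_lateSites] at hx
      rcases le_or_gt x v with hxv | hxv
      · exact absurd hx.2 (not_active_insertMax_of_le hw.1 hv'.1.2 zero_lt_one hx.1.1 hxv
          (hj.2.2.2 (by omega)))
      · obtain ⟨x, rfl⟩ : ∃ y, x = y + 1 := ⟨x - 1, by omega⟩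
        exact ⟨x, mem_lateSites.2 ⟨⟨by omega, by omega⟩,
          ((active_insertMax_of_le (by omega) hw.1 (by omega)).1 hx.2).1⟩, rfl⟩
    · rintro ⟨x, hx, rfl⟩
      have hvx := hmin x hx
      rw [mem_lateSites] at hx
      refine mem_lateSites.2 ⟨⟨by omega, by omega⟩,
        (active_insertMax_of_le hvx hw.1 (by omega)).2 ⟨hx.2, fun p q hpq hq h => ?_⟩⟩
      have := lt_of_forall_not_active hw ha hj hvx hx.1.2 hx.2
        (fun y h1 h2 h3 => by
          have := hmin y (mem_lateSites.2 ⟨⟨h1, by omega⟩, h3⟩)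
          omega) q hq q le_rfl p hpq
      omega
  rw [h0, Finset.card_map]

/-- Without a descent left of `v`, the positions `0, y - 1, y` would increase and block the site
`y`. -/
theorem card_lateSites_insertMax_of_lt (hw : IsPermWord n w)
    (hj : IsPrefixLength n w 1) {v y : ℕ} (hv : v ≤ n) (hy : y ∈ lateSites n w 1) (hyv : y < v) :
    (lateSites (n + 1) (insertMax n w v) 1).card = 0 := by
  rw [mem_lateSites] at hy
  have hdesc : ∃ p q, p < q ∧ q < v ∧ w q < w p := by
    by_contra! h
    have lt : ∀ p q, p < q → q < v → w p < w q := fun p q hpq hq => by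
      have h1 := h p q hpq hq
      have h2 : w p ≠ w q := fun e => by
        have := hw.2 p (by omega) q (by omega) e
        omega
      omega
    exact hy.2.2 0 (y - 1) y (by omega) (by omega) le_rfl (by omega)
      (lt _ _ (by omega) (by omega)) (lt _ _ (by omega) hyv)
  obtain ⟨p, q, hpq, hq, h⟩ := hdesc
  exact card_lateSites_insertMax_of_descent hj hw.1 (by omega) hv hpq hq h

end Children

/-! ### The succession rule -/

/-- The number of descendants, `d` generations later, of an avoider with longest decreasing prefix
of length `j` and `s` active sites beyond it. -/
def numDescendants : ℕ → ℕ → ℕ → ℕ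
  | 0, _, _ => 1
  | d + 1, s, j => numDescendants d s (j + 1) + numDescendants d (s + j) 1
      + ∑ v ∈ Finset.Icc 2 j, numDescendants d 0 v
      + if j = 1 then (if s = 0 then 0 else numDescendants d s 1 + (s - 1) * numDescendants d 0 1)
        else s * numDescendants d 0 j

open Classical in
/-- The length of the longest decreasing prefix. -/
noncomputable def prefixLength (n : ℕ) (w : ℕ → ℕ) : ℕ :=
  if h : ∃ j, IsPrefixLength n w j then h.choose else 0

theorem IsPrefixLength.prefixLength_eq {n : ℕ} {w : ℕ → ℕ} {j : ℕ} (hj : IsPrefixLength n w j) :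
    prefixLength n w = j := by
  have h : ∃ j, IsPrefixLength n w j := ⟨j, hj⟩
  rw [prefixLength, dif_pos h]
  exact h.choose_spec.unique hj

/-- The number of descendants of the avoider `w`, `d` generations later. -/
noncomputable def wordDescendants (d n : ℕ) (w : ℕ → ℕ) : ℕ :=
  numDescendants d (lateSites n w (prefixLength n w)).card (prefixLength n w)

theorem IsPrefixLength.wordDescendants_eq {n : ℕ} {w : ℕ → ℕ} {j s : ℕ}
    (hj : IsPrefixLength n w j) (hs : (lateSites n w j).card = s) (d : ℕ) :
    wordDescendants d n w = numDescendants d s j := by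
  rw [wordDescendants, hj.prefixLength_eq, hs]

open Classical in
theorem sum_wordDescendants_insertMax {n : ℕ} {w : ℕ → ℕ} (hn : 1 ≤ n) (hw : IsPermWord n w)
    (ha : WordAvoids n w) (d : ℕ) :
    ∑ v ∈ (Finset.range (n + 1)).filter (Active n w), wordDescendants d (n + 1) (insertMax n w v)
      = wordDescendants (d + 1) n w := by
  obtain ⟨j, hj⟩ := exists_isPrefixLength hw hn
  have hj1 := hj.1
  have hjn := hj.2.1
  have hsplit : (Finset.range (n + 1)).filter (Active n w)
      = insert 0 (insert 1 (Finset.Icc 2 j ∪ lateSites n w j)) := by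
    ext v
    simp only [Finset.mem_filter, Finset.mem_range, Finset.mem_insert, Finset.mem_union,
      Finset.mem_Icc, mem_lateSites]
    constructor
    · rintro ⟨h1, h2⟩
      have : v = 0 ∨ v = 1 ∨ (2 ≤ v ∧ v ≤ j) ∨ (j < v ∧ v ≤ n) := by omega
      tauto
    · rintro (h | h | h | h)
      · exact ⟨by omega, hj.active (by omega)⟩
      · exact ⟨by omega, hj.active (by omega)⟩
      · exact ⟨by omega, hj.active (by omega)⟩
      · exact ⟨by omega, h.2⟩
  have hdisj : Disjoint (Finset.Icc 2 j) (lateSites n w j) := by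
    rw [Finset.disjoint_left]
    intro x hx hx'
    rw [Finset.mem_Icc] at hx
    rw [mem_lateSites] at hx'
    omega
  rw [hsplit, Finset.sum_insert, Finset.sum_insert, Finset.sum_union hdisj,
    hj.wordDescendants_eq rfl, numDescendants, ← add_assoc, ← add_assoc]
  · congr 1
    · congr 1
      · rw [(hj.insertMax_zero hw.1).wordDescendants_eq (card_lateSites_insertMax_zero hw.1),
          (hj.insertMax_of_le hw.1 le_rfl hj1).wordDescendants_eq
            (card_lateSites_insertMax_one hj hw.1)]
      · refine Finset.sum_congr rfl fun v hv => ?_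
        rw [Finset.mem_Icc] at hv
        exact (hj.insertMax_of_le hw.1 (by omega) hv.2).wordDescendants_eq
          (card_lateSites_insertMax_of_le hj hw.1 hv.1 hv.2) d
    · split_ifs with h1 h2
      · rw [Finset.card_eq_zero] at h2
        rw [h2, Finset.sum_empty]
      · subst h1
        have hne : (lateSites n w 1).Nonempty := by
          rwa [Finset.nonempty_iff_ne_empty, ne_eq, ← Finset.card_eq_zero]
        have hmem := Finset.min'_mem _ hne
        have hmin : ∀ y ∈ lateSites n w 1, (lateSites n w 1).min' hne ≤ y :=
          fun y hy => Finset.min'_le _ y hy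
        generalize (lateSites n w 1).min' hne = v at hmem hmin
        have hv := mem_lateSites.1 hmem
        rw [← Finset.add_sum_erase _ _ hmem,
          (hj.insertMax_of_lt hv.1.1 hv.1.2).wordDescendants_eq
            (card_lateSites_insertMax_min hw ha hj hmem hmin),
          ← Finset.card_erase_of_mem hmem, Finset.sum_const_nat]
        intro x hx
        rw [Finset.mem_erase] at hx
        have h1 := hmin x hx.2
        have h2 := mem_lateSites.1 hx.2
        exact (hj.insertMax_of_lt h2.1.1 h2.1.2).wordDescendants_eq
          (card_lateSites_insertMax_of_lt hw hj h2.1.2 hmem (by omega)) d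
      · refine Finset.sum_const_nat fun x hx => ?_
        have hx := mem_lateSites.1 hx
        exact (hj.insertMax_of_lt hx.1.1 hx.1.2).wordDescendants_eq
          (card_lateSites_insertMax_of_descent hj hw.1 hx.1.1 hx.1.2 zero_lt_one (by omega)
            (hj.lt_of_lt zero_lt_one (by omega))) d
  · simp only [Finset.mem_union, Finset.mem_Icc, mem_lateSites]
    omega
  · simp only [Finset.mem_insert, Finset.mem_union, Finset.mem_Icc, mem_lateSites]
    omega

/-! ### From words to permutations -/

/-- The word of a permutation, continued by zeros. -/
def word {n : ℕ} (σ : Equiv.Perm (Fin n)) (i : ℕ) : ℕ :=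
  if h : i < n then σ ⟨i, h⟩ else 0

@[simp] theorem word_val {n : ℕ} (σ : Equiv.Perm (Fin n)) (i : Fin n) : word σ i = σ i := by
  simp [word]

theorem isPermWord_word {n : ℕ} (σ : Equiv.Perm (Fin n)) : IsPermWord n (word σ) := by
  refine ⟨fun i hi => ?_, fun i hi j hj h => ?_⟩
  · rw [word, dif_pos hi]; exact (σ _).2
  · rw [word, word, dif_pos hi, dif_pos hj] at h
    simpa using σ.injective (Fin.ext h)

/-- Three comparisons between letters adjacent in value fix the relative order of four letters. -/
theorem isAvoider_iff {n : ℕ} (σ : Equiv.Perm (Fin n)) : IsAvoider σ ↔ WordAvoids n (word σ) := by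
  unfold IsAvoider WordAvoids
  refine and_congr ⟨fun h p q r s a b c d x y z => h ?_, fun h => ?_⟩
    ⟨fun h p q r s a b c d x y z => h ?_, fun h => ?_⟩
  · refine ⟨![⟨p, by omega⟩, ⟨q, by omega⟩, ⟨r, by omega⟩, ⟨s, d⟩], ?_, ?_⟩
    · rw [Fin.strictMono_iff_lt_succ]
      intro i
      fin_cases i <;> simpa
    · simp only [word, show p < n by omega, show q < n by omega, show r < n by omega, d,
        dif_pos] at x y z
      intro i j
      fin_cases i <;> fin_cases j <;> simp [-Fin.val_fin_lt, Fin.lt_def] <;> omega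
  · rintro ⟨f, hf, hp⟩
    refine h (f 0) (f 1) (f 2) (f 3) (hf (by decide)) (hf (by decide)) (hf (by decide)) (f 3).2
      ?_ ?_ ?_ <;> simp only [word_val] <;> refine (hp _ _).2 ?_ <;> decide
  · refine ⟨![⟨p, by omega⟩, ⟨q, by omega⟩, ⟨r, by omega⟩, ⟨s, d⟩], ?_, ?_⟩
    · rw [Fin.strictMono_iff_lt_succ]
      intro i
      fin_cases i <;> simpa
    · simp only [word, show p < n by omega, show q < n by omega, show r < n by omega, d,
        dif_pos] at x y z
      intro i j
      fin_cases i <;> fin_cases j <;> simp [-Fin.val_fin_lt, Fin.lt_def] <;> omega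
  · rintro ⟨f, hf, hp⟩
    refine h (f 0) (f 1) (f 2) (f 3) (hf (by decide)) (hf (by decide)) (hf (by decide)) (f 3).2
      ?_ ?_ ?_ <;> simp only [word_val] <;> refine (hp _ _).2 ?_ <;> decide

/-- The permutation `σ` with a new maximum inserted at position `v`. -/
def insertPerm {n : ℕ} (v : Fin (n + 1)) (σ : Equiv.Perm (Fin n)) : Equiv.Perm (Fin (n + 1)) :=
  ((finSuccEquiv' v).trans (Equiv.optionCongr σ)).trans (finSuccEquiv' (Fin.last n)).symm

@[simp] theorem insertPerm_self {n : ℕ} (v : Fin (n + 1)) (σ : Equiv.Perm (Fin n)) :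
    insertPerm v σ v = Fin.last n := by
  simp [insertPerm]

@[simp] theorem insertPerm_succAbove {n : ℕ} (v : Fin (n + 1)) (σ : Equiv.Perm (Fin n))
    (i : Fin n) : insertPerm v σ (v.succAbove i) = (σ i).castSucc := by
  simp [insertPerm]

theorem word_insertPerm {n : ℕ} (v : Fin (n + 1)) (σ : Equiv.Perm (Fin n)) :
    word (insertPerm v σ) = insertMax n (word σ) v := by
  funext i
  rcases Nat.lt_or_ge i (n + 1) with h | h
  · obtain ⟨i, rfl⟩ : ∃ k : Fin (n + 1), i = k := ⟨⟨i, h⟩, rfl⟩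
    rw [word_val]
    rcases Fin.eq_self_or_eq_succAbove v i with rfl | ⟨k, rfl⟩
    · simp
    · have : ((v.succAbove k : Fin (n + 1)) : ℕ) = shift v k := by
        rw [Fin.succAbove, shift]
        split_ifs <;> simp_all [Fin.lt_def]
      rw [insertPerm_succAbove, this, insertMax_shift, word_val, Fin.val_castSucc]
  · have := v.2
    rw [insertMax, if_neg (by omega), if_neg (by omega), word, word, dif_neg (by omega),
      dif_neg (by omega)]

theorem insertPerm_bijective (n : ℕ) :
    Function.Bijective fun x : Fin (n + 1) × Equiv.Perm (Fin n) => insertPerm x.1 x.2 := by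
  rw [Fintype.bijective_iff_injective_and_card]
  constructor
  · rintro ⟨v, σ⟩ ⟨v', σ'⟩ h
    simp only at h
    obtain rfl : v = v' :=
      (insertPerm v' σ').injective (by rw [insertPerm_self, ← h, insertPerm_self])
    congr 1
    ext i
    have := congrArg (fun π => ((π (v.succAbove i) : Fin (n + 1)) : ℕ)) h
    simpa using this
  · simp [Fintype.card_perm, Nat.factorial_succ]

theorem isAvoider_insertPerm {n : ℕ} (v : Fin (n + 1)) (σ : Equiv.Perm (Fin n)) :
    IsAvoider (insertPerm v σ) ↔ IsAvoider σ ∧ Active n (word σ) v := by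
  rw [isAvoider_iff, isAvoider_iff, word_insertPerm,
    wordAvoids_insertMax (isPermWord_word σ).1 (Nat.lt_succ_iff.1 v.2)]

theorem isAvoider_insertPerm_zero {n : ℕ} (σ : Equiv.Perm (Fin n)) :
    IsAvoider (insertPerm 0 σ) ↔ IsAvoider σ := by
  rw [isAvoider_insertPerm, and_iff_left]
  exact ⟨by intros; simp_all, by intros; simp_all⟩

theorem isStartSmall_iff {n : ℕ} (π : Equiv.Perm (Fin (n + 1))) :
    IsStartSmall π ↔ π 0 ≠ Fin.last n := by
  rw [IsStartSmall, ne_eq, not_iff_not]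
  constructor
  · rintro ⟨i, hi, h⟩
    obtain rfl : i = 0 := Fin.ext hi
    have := h (π.symm (Fin.last n))
    rw [Equiv.apply_symm_apply] at this
    exact le_antisymm (Fin.le_last _) this
  · exact fun h => ⟨0, rfl, fun j => h ▸ Fin.le_last _⟩

/-- Avoiders that start with their largest entry correspond to the avoiders one entry shorter. -/
theorem numAvoiders_succ (n : ℕ) :
    numAvoiders (n + 1) = numStartSmallAvoiders (n + 1) + numAvoiders n := by
  classical
  have h1 : numAvoiders n
      = Nat.card {π : Equiv.Perm (Fin (n + 1)) // IsAvoider π ∧ ¬ IsStartSmall π} := by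
    refine Nat.card_congr (Equiv.ofBijective
      (fun σ => ⟨insertPerm 0 σ.1, (isAvoider_insertPerm_zero _).2 σ.2, ?_⟩) ⟨?_, ?_⟩)
    · rw [isStartSmall_iff, not_not, insertPerm_self]
    · intro σ τ h
      have := (insertPerm_bijective n).1 (a₁ := (0, σ.1)) (a₂ := (0, τ.1)) (congrArg Subtype.val h)
      exact Subtype.ext (congrArg Prod.snd this)
    · rintro ⟨π, hπ, hs⟩
      obtain ⟨⟨v, σ⟩, rfl⟩ := (insertPerm_bijective n).2 π
      simp only at hπ hs
      rw [isStartSmall_iff, not_not] at hs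
      obtain rfl : (0 : Fin (n + 1)) = v :=
        (insertPerm v σ).injective (by rw [hs, insertPerm_self])
      exact ⟨⟨σ, (isAvoider_insertPerm_zero _).1 hπ⟩, rfl⟩
  rw [h1, numAvoiders, numStartSmallAvoiders]
  simp only [Nat.card_eq_fintype_card, Fintype.card_subtype]
  rw [← Finset.filter_filter, ← Finset.filter_filter, Finset.card_filter_add_card_filter_not]

open Classical in
theorem sum_wordDescendants {n : ℕ} (hn : 1 ≤ n) (d : ℕ) :
    numAvoiders (n + d)
      = ∑ σ : Equiv.Perm (Fin n) with IsAvoider σ, wordDescendants d n (word σ) := by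
  induction d generalizing n with
  | zero =>
    simp [wordDescendants, numDescendants, numAvoiders, Nat.card_eq_fintype_card,
      Fintype.card_subtype]
  | succ d ih =>
    rw [show n + (d + 1) = n + 1 + d by omega, ih (by omega), Finset.sum_filter,
      ← (insertPerm_bijective n).sum_comp, Fintype.sum_prod_type_right, Finset.sum_filter]
    refine Finset.sum_congr rfl fun σ _ => ?_
    simp only [isAvoider_insertPerm, word_insertPerm]
    split_ifs with h
    · rw [← sum_wordDescendants_insertMax hn (isPermWord_word σ) ((isAvoider_iff σ).1 h),
        Finset.sum_filter, Finset.sum_range]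
      simp only [h, true_and]
    · simp [h]

theorem isAvoider_of_lt_four {n : ℕ} (hn : n < 4) (σ : Equiv.Perm (Fin n)) : IsAvoider σ := by
  rw [isAvoider_iff]
  exact ⟨fun p q r s => by omega, fun p q r s => by omega⟩

theorem numAvoiders_zero : numAvoiders 0 = 1 := by
  rw [numAvoiders, Nat.card_eq_one_iff_unique]
  exact ⟨inferInstance, ⟨1, isAvoider_of_lt_four (by norm_num) 1⟩⟩

theorem numStartSmallAvoiders_zero : numStartSmallAvoiders 0 = 1 := by
  rw [numStartSmallAvoiders, Nat.card_eq_one_iff_unique]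
  exact ⟨inferInstance, ⟨1, isAvoider_of_lt_four (by norm_num) 1, fun ⟨i, _⟩ => i.elim0⟩⟩

theorem numAvoiders_succ_eq (d : ℕ) : numAvoiders (d + 1) = numDescendants d 0 1 := by
  classical
  have hf : (Finset.univ.filter fun σ : Equiv.Perm (Fin 1) => IsAvoider σ) = {1} := by
    ext σ
    simp [isAvoider_of_lt_four, Subsingleton.elim σ 1]
  rw [add_comm, sum_wordDescendants le_rfl, hf, Finset.sum_singleton]
  refine IsPrefixLength.wordDescendants_eq (j := 1) ⟨le_rfl, le_rfl, by omega, by omega⟩ ?_ d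
  rw [Finset.card_eq_zero, Finset.eq_empty_iff_forall_notMem]
  intro x hx
  rw [mem_lateSites] at hx
  omega

/-! ### Solving the recursion with the Catalan series -/

/-- The hypotheses are the constant part and the `s`-part of the rule. For `j = 1` the late sites
contribute `(A 1 + s * B 1) + (s - 1) * A 1 = s * (A 1 + B 1)`, which also vanishes at `s = 0`, so
linearity survives. -/
theorem coeff_eq_numDescendants {A B : ℕ → ℚ⟦X⟧}
    (hA : ∀ j, 1 ≤ j → A j = 1 + X * (A (j + 1) + A 1 + (j : ℚ⟦X⟧) * B 1
      + ∑ v ∈ Finset.Icc 2 j, A v))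
    (hB₁ : B 1 = X * (B 2 + B 1 + B 1 + A 1))
    (hB : ∀ j, 2 ≤ j → B j = X * (B (j + 1) + B 1 + A j)) (d : ℕ) :
    ∀ s j : ℕ, 1 ≤ j → coeff d (A j + (s : ℚ⟦X⟧) * B j) = numDescendants d s j := by
  have key : ∀ s j : ℕ, 1 ≤ j → A j + (s : ℚ⟦X⟧) * B j
      = 1 + X * ((A (j + 1) + (s : ℚ⟦X⟧) * B (j + 1)) + (A 1 + ((s + j : ℕ) : ℚ⟦X⟧) * B 1)
        + ∑ v ∈ Finset.Icc 2 j, (A v + ((0 : ℕ) : ℚ⟦X⟧) * B v)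
        + if j = 1 then (if s = 0 then 0 else (A 1 + (s : ℚ⟦X⟧) * B 1)
            + ((s - 1 : ℕ) : ℚ⟦X⟧) * (A 1 + ((0 : ℕ) : ℚ⟦X⟧) * B 1))
          else (s : ℚ⟦X⟧) * (A j + ((0 : ℕ) : ℚ⟦X⟧) * B j)) := by
    intro s j hj
    simp only [Nat.cast_zero, zero_mul, add_zero, Nat.cast_add]
    have hAj := hA j hj
    split_ifs with h1 h2
    · subst h1 h2
      simp only [Nat.cast_zero] at *
      linear_combination hAj
    · subst h1
      rw [Nat.cast_sub (by omega)]
      simp only [Nat.cast_one] at *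
      linear_combination hAj + (s : ℚ⟦X⟧) * hB₁
    · linear_combination hAj + (s : ℚ⟦X⟧) * hB j (by omega)
  have hcast : ∀ (k : ℕ) (f : ℚ⟦X⟧) (m : ℕ), coeff m ((k : ℚ⟦X⟧) * f) = k * coeff m f := by
    intro k f m
    rw [← nsmul_eq_mul, map_nsmul, nsmul_eq_mul]
  induction d with
  | zero =>
    intro s j hj
    rw [key s j hj]
    simp [numDescendants]
  | succ d ih =>
    intro s j hj
    rw [key s j hj, map_add, coeff_succ_X_mul, coeff_one, if_neg (by omega), zero_add, map_add,
      map_add, map_add, ih s _ (by omega), ih _ 1 le_rfl, map_sum, numDescendants]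
    have hsum : ∑ v ∈ Finset.Icc 2 j, coeff d (A v + ((0 : ℕ) : ℚ⟦X⟧) * B v)
        = ∑ v ∈ Finset.Icc 2 j, (numDescendants d 0 v : ℚ) :=
      Finset.sum_congr rfl fun v hv => ih 0 v (by rw [Finset.mem_Icc] at hv; omega)
    rw [hsum]
    push_cast
    congr 1
    split_ifs with h1 h2
    · simp
    · rw [map_add, hcast, ih s 1 le_rfl]
      have := ih 0 1 le_rfl
      rw [Nat.cast_zero] at this
      rw [this]
    · rw [hcast]
      have := ih 0 j hj
      rw [Nat.cast_zero] at this
      rw [this]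

theorem catalanGF_eq : X * catalanGF ^ 2 = catalanGF - 1 := by
  have h := congrArg (PowerSeries.map (Nat.castRingHom ℚ)) catalanSeries_sq_mul_X_add_one
  have hc : PowerSeries.map (Nat.castRingHom ℚ) catalanSeries = catalanGF := by
    ext n; simp [catalanGF, catalanSeries]
  simp only [map_add, map_mul, map_pow, map_one, PowerSeries.map_X, hc] at h
  linear_combination h

theorem sqrtSeries_eq : sqrtSeries = 1 - 2 * X * catalanGF := by
  have h : (sqrtSeries - (1 - 2 * X * catalanGF)) * (sqrtSeries + (1 - 2 * X * catalanGF)) = 0 := by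
    linear_combination sqrtSeries_sq - 4 * X * catalanGF_eq
  rcases mul_eq_zero.1 h with h | h
  · exact sub_eq_zero.1 h
  -- The other root is excluded: its constant term would give `2 = 0`.
  · have := congrArg constantCoeff h
    simp only [map_add, map_sub, map_mul, constantCoeff_sqrtSeries, map_one, constantCoeff_X,
      mul_zero, zero_mul, map_zero] at this
    norm_num at this

theorem one_sub_X_mul_catalanGF_ne : constantCoeff (1 - X * catalanGF ^ 3) ≠ 0 := by simp

theorem one_sub_X_ne : constantCoeff (1 - X : ℚ⟦X⟧) ≠ 0 := by simp

theorem mk_numDescendants :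
    PowerSeries.mk (fun d => (numDescendants d 0 1 : ℚ)) * (1 - X)
      = (1 - X * catalanGF ^ 3)⁻¹ := by
  have hC := catalanGF_eq
  have hP := PowerSeries.mul_inv_cancel _ one_sub_X_mul_catalanGF_ne
  have hQ := PowerSeries.mul_inv_cancel _ one_sub_X_ne
  generalize (1 - X * catalanGF ^ 3)⁻¹ = P at *
  generalize (1 - X : ℚ⟦X⟧)⁻¹ = Q at *
  generalize catalanGF = c at *
  set b : ℚ⟦X⟧ := X * c ^ 3 * P * Q with hb
  have hb' : b * (1 - X) = X * c ^ 3 * P := by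
    rw [hb]; linear_combination X * c ^ 3 * P * hQ
  clear_value b
  -- Differencing the equations for `A` makes `a j = A j + b` satisfy `a (j+1) - a j = X * a (j+2)`,
  -- solved by multiples of `c ^ j`. The equations at `j = 1` fix `P` and `b`; `B 1` is special
  -- because its rule has an extra `B 1`.
  set A : ℕ → ℚ⟦X⟧ := fun j => P * c ^ (j + 1) - b with hAdef
  set B : ℕ → ℚ⟦X⟧ := fun j => if j = 1 then b else X * P * c ^ (j + 2) with hBdef
  have hB1 : B 1 = b := rfl
  have hA : ∀ j, 1 ≤ j → A j = 1 + X * (A (j + 1) + A 1 + (j : ℚ⟦X⟧) * B 1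
      + ∑ v ∈ Finset.Icc 2 j, A v) := by
    intro j hj
    rw [hB1]
    induction j, hj using Nat.le_induction with
    | base =>
      simp only [hAdef]
      simp
      linear_combination hP - hb' - P * (c + 1) * hC
    | succ j hj ih =>
      rw [Finset.sum_Icc_succ_top (by omega)]
      have hstep : A (j + 1) - A j = X * (A (j + 2) + b) := by
        simp only [hAdef]
        linear_combination - P * c ^ (j + 1) * hC
      push_cast
      linear_combination ih + hstep
  have hB₁ : B 1 = X * (B 2 + B 1 + B 1 + A 1) := by
    simp only [hBdef, hAdef]
    simp
    linear_combination hb' - X * P * c ^ 2 * hC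
  have hB : ∀ j, 2 ≤ j → B j = X * (B (j + 1) + B 1 + A j) := by
    intro j hj
    simp only [hBdef, hAdef, if_neg (show ¬ j = 1 by omega), if_neg (show ¬ j + 1 = 1 by omega),
      if_true]
    linear_combination - X * P * c ^ (j + 1) * hC
  have hmk : PowerSeries.mk (fun d => (numDescendants d 0 1 : ℚ)) = A 1 := by
    ext d
    rw [coeff_mk, ← coeff_eq_numDescendants hA hB₁ hB d 0 1 le_rfl, Nat.cast_zero, zero_mul,
      add_zero]
  rw [hmk]
  simp only [hAdef]
  linear_combination - hb' - P * (1 + c) * hC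

theorem avoiderSeries_mul : avoiderSeries * (1 - X) = startSmallSeries := by
  rw [mul_sub, mul_one, sub_eq_iff_eq_add]
  ext n
  rcases n with _ | n
  · simp [avoiderSeries, startSmallSeries, numAvoiders_zero, numStartSmallAvoiders_zero]
  · rw [map_add, coeff_succ_mul_X]
    simp only [avoiderSeries, startSmallSeries, coeff_mk, numAvoiders_succ]
    push_cast
    ring

theorem avoiderSeries_eq :
    avoiderSeries = 1 + X * PowerSeries.mk (fun d => (numDescendants d 0 1 : ℚ)) := by
  ext n
  rcases n with _ | n
  · simp [avoiderSeries, numAvoiders_zero]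
  · rw [map_add, coeff_succ_X_mul, coeff_one, if_neg (by omega), zero_add]
    simp [avoiderSeries, numAvoiders_succ_eq]

theorem startSmallSeries_eq : startSmallSeries = 1 + X * (1 - X * catalanGF ^ 3)⁻¹ - X := by
  rw [← avoiderSeries_mul, avoiderSeries_eq, ← mk_numDescendants]
  ring

end PermPattern

theorem mainTheorem1 :
    PermPattern.startSmallSeries =
        1 + X * (1 - X * PermPattern.catalanGF ^ 3)⁻¹ - X ∧
      PermPattern.avoiderSeries = PermPattern.startSmallSeries * (1 - X)⁻¹ ∧
      PermPattern.avoiderSeries =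
        (3 * X ^ 2 - 9 * X + 2 + X * (1 - X) * PermPattern.sqrtSeries) *
          (2 * (X - 1) * (X ^ 2 + 4 * X - 1))⁻¹ := by
  refine ⟨PermPattern.startSmallSeries_eq, ?_, ?_⟩
  · rw [PowerSeries.eq_mul_inv_iff_mul_eq PermPattern.one_sub_X_ne, PermPattern.avoiderSeries_mul]
  · rw [PowerSeries.eq_mul_inv_iff_mul_eq
      (by simp [show constantCoeff (2 : ℚ⟦X⟧) = 2 from map_ofNat _ 2]), PermPattern.sqrtSeries_eq]
    have hF := PermPattern.avoiderSeries_mul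
    rw [PermPattern.startSmallSeries_eq] at hF
    have hP := PowerSeries.mul_inv_cancel _ PermPattern.one_sub_X_mul_catalanGF_ne
    have hC := PermPattern.catalanGF_eq
    generalize (1 - X * PermPattern.catalanGF ^ 3)⁻¹ = P at *
    generalize PermPattern.catalanGF = c at *
    -- Up to the factor `X ^ 2`, `X ^ 2 + 4 * X - 1` is the norm of `1 - X * c ^ 3` under
    -- conjugating the square root.
    have hK : P * (X ^ 2 + 4 * X - 1) = -1 + 2 * X + X * c - X ^ 2 * c + X ^ 2 := by
      linear_combination (-1 + 2 * X + X * c - X ^ 2 * c + X ^ 2) * hP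
        + P * X * (X * (c - c ^ 2) + 2 + c + c ^ 2) * hC
    linear_combination (-2) * (X ^ 2 + 4 * X - 1) * hF - 2 * X * hK
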